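/- Let $k\ge 1$ be an integer, $\theta_e>0$, $L_p,L_s>0$, $\hat\gamma_p>0$ and $0\le\alpha<1$, and let the channel gains $g_p$ and $g_s$ be independent random variables, each Gamma distributed with shape $k$ and scale $\theta_e$. Put $$\zeta_2=\frac{\alpha}{(1-\alpha)(1+\hat\gamma_p)},\quad \psi=\frac{\hat\gamma_p(1-\alpha)L_s}{L_p\theta_e},\quad \tau_1=\frac{\hat\gamma_p}{L_p\theta_e},\quad \tau_2=\frac{\tau_1}{\zeta_2+1},$$ and let $\mathrm{ER}_2$ be the Case II ergodic rate, that is, the expectation of $\log_2\!\big((1+\zeta_2)L_pg_p/\hat\gamma_p-\zeta_2\big)$ over the event $\hat\gamma_p\le L_pg_p\le\hat\gamma_p\,(1+(1-\alpha)L_sg_s)$. Write $\operatorname{Ei}(x)=-\int_{-x}^\infty e^{-t}t^{-1}\,dt$ for $x<0$, $(a)_n=a(a+1)\cdots(a+n-1)$, ${}_2F_2(a_1,a_2;b_1,b_2;x)=\sum_{n\ge0}\frac{(a_1)_n(a_2)_n}{(b_1)_n(b_2)_n}\frac{x^n}{n!}$, and, for $c>0$ and an integer $n\ge0$, $$E_n(c)=\sum_{t=1}^{n}(t-1)!\,(-c)^{n-t}+(-1)^{n-1}c^{\,n}e^{c}\operatorname{Ei}(-c).$$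 For $1\le\kappa\le k$ consider the infinite series $$\sum_{j=0}^\infty\ \sum_{f=0}^{\kappa+j}\binom{\kappa+j}{f}\frac{(-1)^j\,\tau_2^{\kappa+j-f}(\theta_e\psi)^f\,(k)_f}{j!\,(\kappa+j)^2}.\qquad(*)$$ For real numbers $S_1,\dots,S_k$ let $$\begin{aligned}\mathcal E(S)=\frac{e^{-\zeta_2\tau_1/(\zeta_2+1)}}{\Gamma(k)\ln2}\sum_{i=0}^{k-1}\binom{k-1}{i}(\zeta_2\tau_2)^i\Bigg\{&\Gamma(\kappa)\sum_{q=0}^{k-1}\frac{E_{k-q-1}\!\big(\tfrac{\tau_2}{\theta_e\psi}\big)}{(k-q-1)!}\\&-\sum_{a=0}^{\kappa-1}\sum_{n=0}^{a}\binom an\frac{e^{-\tau_2}(\kappa-1)!\,\tau_2^{a-n}(\theta_e\psi)^n}{a!\,\Gamma(k)(\theta_e\psi+1)^{k+n}}\Big[\ln(\tau_2)\Gamma(k+n)\\&\qquad+\sum_{e=0}^{k+n-1}\frac{(k+n-1)!}{(k+n-e-1)!}E_{k+n-e-1}\!\big(\tfrac{\tau_2(\theta_e\psi+1)}{\theta_e\psi}\big)\Big]\\&-\sum_{b=0}^{\kappa-1}\sum_{c=0}^{b}\binom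 bc\ln\!\big(\tfrac1{\tau_2}\big)\frac{e^{-\tau_2}(\kappa-1)!\,\tau_2^{b-c}(\theta_e\psi)^c(k)_c}{b!\,(\theta_e\psi+1)^{k+c}}\\&-S_\kappa+\frac{\tau_2^\kappa}{\kappa^2}\,{}_2F_2(\kappa,\kappa;\kappa+1,\kappa+1;-\tau_2)\Bigg\},\qquad\kappa=k-i.\end{aligned}$$ Then: 1. The expectation defining $\mathrm{ER}_2$ is finite (the rate is integrable over the Case II event). 2. Whenever the series $(*)$ converges for every $\kappa=1,\dots,k$, with sums $S_1,\dots,S_k$, one has $\mathrm{ER}_2=\mathcal E(S)$. 3. For each $\kappa\in\{1,\dots,k\}$ the series $(*)$ converges absolutely if and only if $\theta_e\psi<1$, i.e. $\hat\gamma_p(1-\alpha)L_s<L_p$. 4. For all parameters, $\mathrm{ER}_2=\mathcal E(S)$ with $S_\kappa=\mathbb E\Big[\frac{(\tau_2+\psi g_s)^\kappa}{\kappa^2}\,{}_2F_2\big(\kappa,\kappa;\kappa+1,\kappa+1;-(\tau_2+\psi g_s)\big)\Big]$, that is, with the series summed under the expectation over $g_s$; these expectations are finite. -/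

import Mathlib

open MeasureTheory ProbabilityTheory Filter Topology

noncomputable section

/-- The exponential integral `Ei x = - ∫_{-x}^∞ e^{-t} / t dt`. It is only used at negative
arguments `x`, where the integral converges absolutely. -/
def Ei (x : ℝ) : ℝ := -∫ t in Set.Ioi (-x), Real.exp (-t) / t

/-- The Pochhammer symbol `(a)_n = a (a + 1) ⋯ (a + n - 1)`. -/
def poch (a : ℝ) (n : ℕ) : ℝ := (ascPochhammer ℝ n).eval a

/-- The generalized hypergeometric function `₂F₂(a₁, a₂; b₁, b₂; x)`. -/
def hyp2F2 (a₁ a₂ b₁ b₂ x : ℝ) : ℝ :=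
  ∑' n : ℕ, poch a₁ n * poch a₂ n / (poch b₁ n * poch b₂ n) * (x ^ n / (n.factorial : ℝ))

/-- The numerical parameters of the model: the common shape `k` and scale `θe` of the two Gamma
laws, the rate-splitting factor `α`, the target SINR `γp` of the primary user and the effective
power factors `Lp`, `Ls`. -/
structure Params where
  k : ℕ
  α : ℝ
  γp : ℝ
  Lp : ℝ
  Ls : ℝ
  θe : ℝ

namespace Params

variable (p : Params)

def ζ2 : ℝ := p.α / ((1 - p.α) * (1 + p.γp))

def ψ : ℝ := p.γp * (1 - p.α) * p.Ls / (p.Lp * p.θe)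

def τ1 : ℝ := p.γp / (p.Lp * p.θe)

def τ2 : ℝ := p.τ1 / (p.ζ2 + 1)

/-- Case II for the channel gains `gp = x`, `gs = y`. -/
def InCaseII (x y : ℝ) : Prop :=
  p.γp ≤ p.Lp * x ∧ p.Lp * x ≤ p.γp * (1 + (1 - p.α) * p.Ls * y)

/-- The rate of the secondary user in Case II, for the channel gain `gp = x`. -/
def rateII (x : ℝ) : ℝ := Real.logb 2 ((1 + p.ζ2) * (p.Lp * x) / p.γp - p.ζ2)

/-- The Case II ergodic rate: the expectation of the rate over the Case II event. -/
def ER2 {Ω : Type*} [MeasurableSpace Ω] (P : Measure Ω) (gp gs : Ω → ℝ) : ℝ :=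
  ∫ ω in {ω | p.InCaseII (gp ω) (gs ω)}, p.rateII (gp ω) ∂P

/-- `∑_{t=1}^{n} (t-1)! (-c)^{n-t} + (-1)^{n-1} e^c Ei(-c) / (1/c)^n`. -/
def eiBlock (c : ℝ) (n : ℕ) : ℝ :=
  ∑ t ∈ Finset.Icc 1 n, ((t - 1).factorial : ℝ) * (-c) ^ (n - t)
    + (-1 : ℝ) ^ ((n : ℤ) - 1) * Real.exp c * Ei (-c) / (1 / c) ^ n

/-- The first finite sum of the closed form (for a given `κ`). -/
def sumA (κ : ℕ) : ℝ :=
  Real.Gamma κ * ∑ q ∈ Finset.range p.k,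
    1 / ((p.k - q - 1).factorial : ℝ) * eiBlock (p.τ2 / (p.θe * p.ψ)) (p.k - q - 1)

/-- The second finite sum of the closed form. -/
def sumB (κ : ℕ) : ℝ :=
  ∑ a ∈ Finset.range κ, ∑ n ∈ Finset.range (a + 1),
    (a.choose n : ℝ)
      * (Real.exp (-p.τ2) * ((κ - 1).factorial : ℝ) * p.τ2 ^ (a - n) * (p.θe * p.ψ) ^ n
        / ((a.factorial : ℝ) * Real.Gamma p.k * (p.θe * p.ψ + 1) ^ (p.k + n)))
      * (Real.log p.τ2 * Real.Gamma ((p.k : ℝ) + n)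
        + ∑ e ∈ Finset.range (p.k + n),
          ((p.k + n - 1).factorial : ℝ) / ((p.k + n - e - 1).factorial : ℝ)
            * eiBlock (p.τ2 * (p.θe * p.ψ + 1) / (p.θe * p.ψ)) (p.k + n - e - 1))

/-- The third finite sum of the closed form. -/
def sumC (κ : ℕ) : ℝ :=
  ∑ b ∈ Finset.range κ, ∑ c ∈ Finset.range (b + 1),
    (b.choose c : ℝ) * Real.log (1 / p.τ2)
      * (Real.exp (-p.τ2) * ((κ - 1).factorial : ℝ) * p.τ2 ^ (b - c) * (p.θe * p.ψ) ^ c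
          * poch p.k c
        / ((b.factorial : ℝ) * (p.θe * p.ψ + 1) ^ (p.k + c)))

/-- The term of index `j` of the infinite series of the closed form. -/
def seriesTerm (κ j : ℕ) : ℝ :=
  ∑ f ∈ Finset.range (κ + j + 1),
    ((κ + j).choose f : ℝ)
      * ((-1) ^ j * p.τ2 ^ (κ + j - f) * (p.θe * p.ψ) ^ f * poch p.k f
        / ((j.factorial : ℝ) * ((κ : ℝ) + j) ^ 2))

/-- `z^κ / κ² · ₂F₂(κ, κ; κ + 1, κ + 1; -z)`. -/
def hypTerm (κ : ℕ) (z : ℝ) : ℝ :=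
  z ^ κ / (κ : ℝ) ^ 2 * hyp2F2 κ κ ((κ : ℝ) + 1) ((κ : ℝ) + 1) (-z)

/-- The closed form, with `κ = k - i`; `S κ` stands for the value of the infinite series
`∑_j seriesTerm κ j`. -/
def closedForm (S : ℕ → ℝ) : ℝ :=
  Real.exp (-(p.ζ2 * p.τ1 / (p.ζ2 + 1))) / (Real.Gamma p.k * Real.log 2)
    * ∑ i ∈ Finset.range p.k, ((p.k - 1).choose i : ℝ) * (p.ζ2 * p.τ2) ^ i
      * (p.sumA (p.k - i) - p.sumB (p.k - i) - p.sumC (p.k - i) - S (p.k - i)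
        + hypTerm (p.k - i) p.τ2)

end Params

end

noncomputable section

/-! Write `w = θe ψ`. After division by `θe` the gains become independent unit-scale Gamma variables
X and Y, the event is τ1 ≤ X ≤ τ1 + wY, and the rate is log₂(X/τ2 - ζ2). Since τ1 = τ2 + ζ2 τ2, the
shift X = u + ζ2 τ2 turns the rate into log₂(u/τ2) and the range into [τ2, τ2 + wY]. The binomial
theorem for (u + ζ2 τ2)^(k-1) then leaves integrals of log(u/τ2) u^(κ-1) e^(-u) with κ = k - i
(`integral_normRate_Icc`).

For fixed κ the functions G_r = `gammaSeries κ r` satisfy z G_{r+1}' = G_r. Integration by parts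
therefore gives log(z/τ2) G_1(z) - G_2(z) + G_2(τ2) at z = τ2 + wY. The function G_1 is elementary,
and the expectation of its product with the logarithm is the finite part of the closed form
(`integrable_and_integral_log_mul_gammaSeries_one`). The ₂F₂ terms are values of G_2, and the bound
G_2(z) ≤ z^κ/κ² makes E G_2(z) finite for every w. This proves the formula with the series under the
expectation.

The series (*) is the termwise expectation of G_2(z). Its terms dominate w^(κ+j)/(κ+j) in absolute
value, which rules out absolute convergence for w ≥ 1; for w < 1 the majorant z^κ e^z is integrable.
Mere convergence only yields w ≤ 1, so its value is found by Abel summation: with weights r^j, r <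
1, expectation and sum commute (`hasSum_seriesTerm_mul_pow`), and r → 1 is taken by dominated
convergence. -/

/-! ### The functions `gammaSeries κ r` and the integral over the primary gain. -/

/-- The series `∑_j (-1)^j z^(κ+j) / (j! (κ+j)^r)`: it is `z^κ e^{-z}` for `r = 0`, the lower
incomplete Gamma function for `r = 1` and a `₂F₂` function for `r = 2`. -/
def gammaSeries (κ r : ℕ) (z : ℝ) : ℝ :=
  ∑' j : ℕ, (-1 : ℝ) ^ j * z ^ (κ + j) / ((j.factorial : ℝ) * ((κ : ℝ) + j) ^ r)

theorem one_le_add_pow {κ : ℕ} (hκ : 1 ≤ κ) (j r : ℕ) : 1 ≤ ((κ : ℝ) + j) ^ r := by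
  have : (1 : ℝ) ≤ κ := by exact_mod_cast hκ
  exact one_le_pow₀ (by have := Nat.cast_nonneg (α := ℝ) j; linarith)

theorem abs_gammaSeries_term_le {κ : ℕ} (hκ : 1 ≤ κ) (r j : ℕ) (z : ℝ) :
    |(-1 : ℝ) ^ j * z ^ (κ + j) / ((j.factorial : ℝ) * ((κ : ℝ) + j) ^ r)|
      ≤ |z| ^ κ * (|z| ^ j / (j.factorial : ℝ)) := by
  have h1 := one_le_add_pow hκ j r
  have hj : (0 : ℝ) < j.factorial := by positivity
  rw [abs_div, abs_mul, abs_pow, abs_neg, abs_one, one_pow, one_mul, abs_pow, pow_add,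
    abs_of_pos (show 0 < (j.factorial : ℝ) * ((κ : ℝ) + j) ^ r by positivity), mul_div_assoc]
  gcongr
  exact le_mul_of_one_le_right hj.le h1

theorem summable_gammaSeries {κ : ℕ} (hκ : 1 ≤ κ) (r : ℕ) (z : ℝ) :
    Summable fun j : ℕ =>
      (-1 : ℝ) ^ j * z ^ (κ + j) / ((j.factorial : ℝ) * ((κ : ℝ) + j) ^ r) :=
  .of_norm_bounded ((Real.summable_pow_div_factorial |z|).mul_left _)
    fun j => abs_gammaSeries_term_le hκ r j z

theorem gammaSeries_zero_right {κ : ℕ} (hκ : 1 ≤ κ) (r : ℕ) : gammaSeries κ r 0 = 0 := by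
  unfold gammaSeries
  convert! tsum_zero with j
  rw [zero_pow (by omega)]
  simp

theorem gammaSeries_zero (κ : ℕ) (z : ℝ) : gammaSeries κ 0 z = z ^ κ * Real.exp (-z) := by
  rw [Real.exp_eq_exp_ℝ, NormedSpace.exp_eq_tsum_div, ← tsum_mul_left]
  unfold gammaSeries
  refine tsum_congr fun j => ?_
  rw [neg_pow z, pow_add, pow_zero]
  ring

/-- Termwise differentiation on a ball containing z. The derivative stays a series, without division
by z, so that z = 0 is covered; continuity everywhere depends on this. -/
theorem hasDerivAt_gammaSeries_tsum {κ : ℕ} (hκ : 1 ≤ κ) (r : ℕ) (z : ℝ) :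
    HasDerivAt (gammaSeries κ (r + 1))
      (∑' j : ℕ, (-1 : ℝ) ^ j * z ^ (κ + j - 1) / ((j.factorial : ℝ) * ((κ : ℝ) + j) ^ r)) z := by
  set R := |z| + 1
  have hR : 0 < R := by positivity
  change HasDerivAt (fun z => ∑' j : ℕ,
    (-1 : ℝ) ^ j * z ^ (κ + j) / ((j.factorial : ℝ) * ((κ : ℝ) + j) ^ (r + 1))) _ z
  refine hasDerivAt_tsum_of_isPreconnected
    (g := fun j z => (-1 : ℝ) ^ j * z ^ (κ + j) / ((j.factorial : ℝ) * ((κ : ℝ) + j) ^ (r + 1)))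
    (g' := fun j z =>
      (-1 : ℝ) ^ j * z ^ (κ + j - 1) / ((j.factorial : ℝ) * ((κ : ℝ) + j) ^ r))
    (u := fun j : ℕ => R ^ (κ - 1) * (R ^ j / (j.factorial : ℝ))) (t := Metric.ball 0 R) (y₀ := 0)
    ((Real.summable_pow_div_factorial R).mul_left _) Metric.isOpen_ball
    (convex_ball 0 R).isPreconnected ?_ ?_ (by simpa using hR) (summable_gammaSeries hκ _ _)
    (by simp [R])
  · intro j y _
    have h1 : ((κ : ℝ) + j) ≠ 0 := by positivity
    have hf : (j.factorial : ℝ) ≠ 0 := by positivity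
    convert! ((hasDerivAt_pow (κ + j) y).const_mul ((-1 : ℝ) ^ j)).div_const
      ((j.factorial : ℝ) * ((κ : ℝ) + j) ^ (r + 1)) using 1
    push_cast
    field_simp
    ring
  · intro j y hy
    have hy' : |y| ≤ R := by simpa using (Metric.mem_ball.1 hy).le
    have h1 := one_le_add_pow hκ j r
    have hj : (0 : ℝ) < j.factorial := by positivity
    rw [Real.norm_eq_abs, abs_div, abs_mul, abs_pow, abs_neg, abs_one, one_pow, one_mul, abs_pow,
      abs_of_pos (show 0 < (j.factorial : ℝ) * ((κ : ℝ) + j) ^ r by positivity),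
      ← mul_div_assoc, ← pow_add, show κ - 1 + j = κ + j - 1 by omega]
    gcongr
    exact le_mul_of_one_le_right hj.le h1

theorem hasDerivAt_gammaSeries {κ : ℕ} (hκ : 1 ≤ κ) (r : ℕ) {z : ℝ} (hz : z ≠ 0) :
    HasDerivAt (gammaSeries κ (r + 1)) (gammaSeries κ r z / z) z := by
  convert! hasDerivAt_gammaSeries_tsum hκ r z using 1
  rw [div_eq_mul_inv, mul_comm, gammaSeries, ← tsum_mul_left]
  refine tsum_congr fun j => ?_
  rw [show κ + j = (κ + j - 1) + 1 by omega, pow_succ, Nat.add_sub_cancel]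
  field_simp

theorem continuous_gammaSeries {κ : ℕ} (hκ : 1 ≤ κ) : ∀ r, Continuous (gammaSeries κ r)
  | 0 => by
    rw [show gammaSeries κ 0 = fun z => z ^ κ * Real.exp (-z) from funext (gammaSeries_zero κ)]
    fun_prop
  | r + 1 => continuous_iff_continuousAt.2 fun z => (hasDerivAt_gammaSeries_tsum hκ r z).continuousAt

/-- Monotonicity on [0, ∞). The derivative is only required at z > 0, where `hasDerivAt_gammaSeries`
may divide by z. -/
theorem nonneg_of_hasDerivAt_nonneg {f f' : ℝ → ℝ} (hf : Continuous f) (h0 : f 0 = 0)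
    (hd : ∀ z, 0 < z → HasDerivAt f (f' z) z) (hf' : ∀ z, 0 < z → 0 ≤ f' z) {z : ℝ} (hz : 0 ≤ z) :
    0 ≤ f z := by
  rw [← h0]
  refine monotoneOn_of_deriv_nonneg (convex_Ici 0) hf.continuousOn (fun x hx => ?_) (fun x hx => ?_)
    Set.self_mem_Ici hz hz
  · rw [interior_Ici] at hx
    exact (hd x hx).differentiableAt.differentiableWithinAt
  · rw [interior_Ici] at hx
    rw [(hd x hx).deriv]
    exact hf' x hx

theorem gammaSeries_nonneg {κ : ℕ} (hκ : 1 ≤ κ) (r : ℕ) {z : ℝ} (hz : 0 ≤ z) :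
    0 ≤ gammaSeries κ r z := by
  induction r generalizing z with
  | zero => rw [gammaSeries_zero]; positivity
  | succ r ih =>
    exact nonneg_of_hasDerivAt_nonneg (continuous_gammaSeries hκ _) (gammaSeries_zero_right hκ _)
      (fun z hz => hasDerivAt_gammaSeries hκ r hz.ne') (fun z hz => div_nonneg (ih hz.le) hz.le) hz

/-- Induction on r: the gap at r + 1 vanishes at 0 and has derivative (gap at r)/z. The bound is
polynomial, hence integrable for every w, unlike the exponential majorant of the series. -/
theorem gammaSeries_le {κ : ℕ} (hκ : 1 ≤ κ) (r : ℕ) {z : ℝ} (hz : 0 ≤ z) :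
    gammaSeries κ r z ≤ z ^ κ / (κ : ℝ) ^ r := by
  induction r generalizing z with
  | zero =>
    rw [gammaSeries_zero, pow_zero, div_one]
    exact mul_le_of_le_one_right (by positivity) (Real.exp_le_one_iff.2 (by linarith))
  | succ r ih =>
    have hκ0 : (κ : ℝ) ≠ 0 := by positivity
    have := nonneg_of_hasDerivAt_nonneg (f := fun z => z ^ κ / (κ : ℝ) ^ (r + 1) -
      gammaSeries κ (r + 1) z) (f' := fun z => (z ^ κ / (κ : ℝ) ^ r - gammaSeries κ r z) / z)
      (by have := continuous_gammaSeries hκ (r + 1); fun_prop)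
      (by simp [gammaSeries_zero_right hκ, show κ ≠ 0 by omega])
      (fun z hz => by
        refine (((hasDerivAt_pow κ z).div_const _).sub
          (hasDerivAt_gammaSeries hκ r hz.ne')).congr_deriv ?_
        rw [sub_div]
        congr 1
        obtain ⟨n, rfl⟩ : ∃ n, κ = n + 1 := ⟨κ - 1, by omega⟩
        rw [Nat.add_sub_cancel, pow_succ z, pow_succ ((n + 1 : ℕ) : ℝ)]
        field_simp)
      (fun z hz => div_nonneg (sub_nonneg.2 (ih hz.le)) hz.le) hz
    linarith

theorem hasDerivAt_expPartialSum (κ : ℕ) (z : ℝ) :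
    HasDerivAt (fun z : ℝ => ∑ a ∈ Finset.range (κ + 1), z ^ a / (a.factorial : ℝ))
      (∑ a ∈ Finset.range κ, z ^ a / (a.factorial : ℝ)) z := by
  induction κ with
  | zero => simpa using hasDerivAt_const z (1 : ℝ)
  | succ n ih =>
    rw [Finset.sum_range_succ]
    simp_rw [Finset.sum_range_succ _ (n + 1)]
    refine ih.add (((hasDerivAt_pow (n + 1) z).div_const _).congr_deriv ?_)
    rw [Nat.factorial_succ]
    push_cast
    field_simp

/-- The lower incomplete Gamma function at integer parameters. -/
theorem gammaSeries_one {κ : ℕ} (hκ : 1 ≤ κ) {z : ℝ} (hz : 0 ≤ z) :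
    gammaSeries κ 1 z = ((κ - 1).factorial : ℝ)
      * (1 - Real.exp (-z) * ∑ a ∈ Finset.range κ, z ^ a / (a.factorial : ℝ)) := by
  obtain ⟨n, rfl⟩ : ∃ n, κ = n + 1 := ⟨κ - 1, by omega⟩
  simp only [Nat.add_sub_cancel]
  set g : ℝ → ℝ := fun z => (n.factorial : ℝ)
      * (1 - Real.exp (-z) * ∑ a ∈ Finset.range (n + 1), z ^ a / (a.factorial : ℝ)) with hg
  have hgd : ∀ z, HasDerivAt g (z ^ n * Real.exp (-z)) z := fun z => by
    refine ((((hasDerivAt_neg z).exp.mul (hasDerivAt_expPartialSum n z)).const_sub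
      1).const_mul _).congr_deriv ?_
    rw [Finset.sum_range_succ]
    field_simp
    ring
  have hgc : Continuous g := continuous_iff_continuousAt.2 fun z => (hgd z).continuousAt
  have hg0 : g 0 = 0 := by simp [hg, Finset.sum_range_succ']
  have hs0 := gammaSeries_zero_right hκ 1
  have hsc := continuous_gammaSeries hκ 1
  have hsd : ∀ z, 0 < z → HasDerivAt (gammaSeries (n + 1) 1) (z ^ n * Real.exp (-z)) z :=
    fun z hz => (hasDerivAt_gammaSeries hκ 0 hz.ne').congr_deriv (by
      rw [gammaSeries_zero, pow_succ]; field_simp)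
  -- Both sides vanish at 0 and have the same derivative for z > 0; equality comes as two
  -- inequalities.
  have h1 := nonneg_of_hasDerivAt_nonneg (f := fun z => gammaSeries (n + 1) 1 z - g z)
    (hsc.sub hgc) (by simp [hs0, hg0]) (fun z hz => (hsd z hz).sub (hgd z)) (by simp) hz
  have h2 := nonneg_of_hasDerivAt_nonneg (f := fun z => g z - gammaSeries (n + 1) 1 z)
    (hgc.sub hsc) (by simp [hs0, hg0]) (fun z hz => (hgd z).sub (hsd z hz)) (by simp) hz
  change gammaSeries (n + 1) 1 z = g z
  linarith

/-- By z G_1' = G_0 and z G_2' = G_1, the function log(u/τ) G_1(u) - G_2(u) is an antiderivative. -/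
theorem integral_log_div_mul_pow_mul_exp {κ : ℕ} (hκ : 1 ≤ κ) {τ z : ℝ} (hτ : 0 < τ)
    (hz : τ ≤ z) :
    ∫ u in τ..z, Real.log (u / τ) * (u ^ (κ - 1) * Real.exp (-u))
      = Real.log (z / τ) * gammaSeries κ 1 z - gammaSeries κ 2 z + gammaSeries κ 2 τ := by
  have hpos : ∀ u ∈ Set.uIcc τ z, 0 < u := fun u hu => by
    rw [Set.uIcc_of_le hz] at hu
    exact hτ.trans_le hu.1
  rw [intervalIntegral.integral_eq_sub_of_hasDerivAt
    (f := fun u => Real.log (u / τ) * gammaSeries κ 1 u - gammaSeries κ 2 u)]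
  · rw [div_self hτ.ne', Real.log_one]
    ring
  · intro u hu
    have h0 := hpos u hu
    refine (((((hasDerivAt_id u).div_const τ).log (by positivity)).mul
      (hasDerivAt_gammaSeries hκ 0 h0.ne')).sub
      (hasDerivAt_gammaSeries hκ 1 h0.ne')).congr_deriv ?_
    obtain ⟨n, rfl⟩ : ∃ n, κ = n + 1 := ⟨κ - 1, by omega⟩
    simp only [gammaSeries_zero, Nat.add_sub_cancel, pow_succ, id]
    field_simp
    ring
  · refine ContinuousOn.intervalIntegrable fun u hu => ContinuousAt.continuousWithinAt ?_
    have h0 := hpos u hu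
    have : u / τ ≠ 0 := by positivity
    fun_prop (disch := assumption)

theorem poch_div_poch_succ {κ : ℕ} (hκ : 1 ≤ κ) (n : ℕ) :
    poch κ n / poch ((κ : ℝ) + 1) n = κ / ((κ : ℝ) + n) := by
  have hκ0 : (0 : ℝ) < κ := by exact_mod_cast hκ
  have h1 : 0 < poch ((κ : ℝ) + 1) n := ascPochhammer_pos n _ (by linarith)
  rw [div_eq_div_iff h1.ne' (by positivity)]
  have e1 := ascPochhammer_succ_eval n (κ : ℝ)
  have e2 : (ascPochhammer ℝ (n + 1)).eval (κ : ℝ) = κ * poch ((κ : ℝ) + 1) n := by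
    rw [ascPochhammer_succ_left]
    simp [poch, Polynomial.eval_comp]
  unfold poch at *
  rw [← e1, e2]

theorem hypTerm_eq_gammaSeries {κ : ℕ} (hκ : 1 ≤ κ) (z : ℝ) :
    Params.hypTerm κ z = gammaSeries κ 2 z := by
  have hκ0 : (0 : ℝ) < κ := by exact_mod_cast hκ
  unfold Params.hypTerm hyp2F2 gammaSeries
  rw [← tsum_mul_left]
  refine tsum_congr fun j => ?_
  rw [mul_div_mul_comm, poch_div_poch_succ hκ, neg_pow z, pow_add]
  field_simp

/-! ### Logarithmic integrals over the half-line and exponential integrals. -/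

theorem integrableOn_pow_mul_exp_neg (n : ℕ) :
    IntegrableOn (fun v : ℝ => v ^ n * Real.exp (-v)) (Set.Ioi 0) := by
  have := Real.GammaIntegral_convergent (s := n + 1) (by positivity)
  refine this.congr_fun (fun v _ => ?_) measurableSet_Ioi
  simp [mul_comm]

theorem integral_pow_mul_exp_neg (n : ℕ) :
    ∫ v in Set.Ioi (0 : ℝ), v ^ n * Real.exp (-v) = (n.factorial : ℝ) := by
  rw [← Real.Gamma_nat_eq_factorial, Real.Gamma_eq_integral (by positivity)]
  refine setIntegral_congr_fun measurableSet_Ioi (fun v _ => ?_)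
  simp [mul_comm]

theorem integrableOn_pow_mul_exp_neg_div {c : ℝ} (hc : 0 < c) (n : ℕ) :
    IntegrableOn (fun v : ℝ => v ^ n * Real.exp (-v) / (v + c)) (Set.Ioi 0) := by
  refine ((integrableOn_pow_mul_exp_neg n).div_const c).mono' ?_ ?_
  · exact (by fun_prop : Measurable _).aestronglyMeasurable
  · refine ae_restrict_of_forall_mem measurableSet_Ioi fun v (hv : 0 < v) => ?_
    rw [Real.norm_of_nonneg (by positivity)]
    gcongr
    linarith

theorem log_one_add_div_nonneg {c v : ℝ} (hc : 0 < c) (hv : 0 ≤ v) : 0 ≤ Real.log (1 + v / c) :=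
  Real.log_nonneg (by have : 0 ≤ v / c := by positivity
                      linarith)

theorem log_one_add_div_le {c v : ℝ} (hc : 0 < c) (hv : 0 ≤ v) : Real.log (1 + v / c) ≤ v / c := by
  have := Real.log_le_sub_one_of_pos (x := 1 + v / c) (by positivity)
  linarith

theorem log_mul_pow_mul_exp_neg_le {c v : ℝ} (hc : 0 < c) (hv : 0 ≤ v) (n : ℕ) :
    Real.log (1 + v / c) * (v ^ n * Real.exp (-v)) ≤ c⁻¹ * (v ^ (n + 1) * Real.exp (-v)) := by
  calc _ ≤ v / c * (v ^ n * Real.exp (-v)) := by gcongr; exact log_one_add_div_le hc hv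
    _ = _ := by ring

theorem integrableOn_log_mul_pow_mul_exp_neg {c : ℝ} (hc : 0 < c) (n : ℕ) :
    IntegrableOn (fun v : ℝ => Real.log (1 + v / c) * (v ^ n * Real.exp (-v))) (Set.Ioi 0) := by
  refine ((integrableOn_pow_mul_exp_neg (n + 1)).const_mul c⁻¹).mono' ?_ ?_
  · exact (by fun_prop : Measurable _).aestronglyMeasurable
  · refine ae_restrict_of_forall_mem measurableSet_Ioi fun v (hv : 0 < v) => ?_
    have := log_one_add_div_nonneg hc hv.le
    rw [Real.norm_of_nonneg (by positivity)]
    exact log_mul_pow_mul_exp_neg_le hc hv.le n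

theorem tendsto_log_mul_pow_mul_exp_neg {c : ℝ} (hc : 0 < c) (n : ℕ) :
    Tendsto (fun v : ℝ => Real.log (1 + v / c) * (v ^ n * Real.exp (-v))) atTop (𝓝 0) := by
  have h := (Real.tendsto_pow_mul_exp_neg_atTop_nhds_zero (n + 1)).const_mul c⁻¹
  rw [mul_zero] at h
  refine squeeze_zero' ?_ ?_ h
  · filter_upwards [eventually_ge_atTop 0] with v hv
    have := log_one_add_div_nonneg hc hv
    positivity
  · filter_upwards [eventually_ge_atTop 0] with v hv
    exact log_mul_pow_mul_exp_neg_le hc hv n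

theorem exp_mul_neg_Ei {c : ℝ} :
    Real.exp c * -Ei (-c) = ∫ v in Set.Ioi (0 : ℝ), Real.exp (-v) / (v + c) := by
  rw [Ei, neg_neg, neg_neg, ← integral_const_mul,
    ← (measurePreserving_add_right volume c).setIntegral_preimage_emb
      (measurableEmbedding_addRight c) _ (Set.Ioi c)]
  simp only [Set.preimage_add_const_Ioi, sub_self]
  refine integral_congr_ae (.of_forall fun v => ?_)
  simp only [neg_add, Real.exp_add, Real.exp_neg c]
  field_simp

/-- This is the recursion that v^(n+1)/(v + c) = v^n - c v^n/(v + c) gives for the integrals in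
`eiBlock_eq_integral`. -/
theorem eiBlock_succ {c : ℝ} (hc : 0 < c) (n : ℕ) :
    Params.eiBlock c (n + 1) = (n.factorial : ℝ) - c * Params.eiBlock c n := by
  unfold Params.eiBlock
  rw [Finset.sum_Icc_succ_top (by omega), mul_add, Finset.mul_sum]
  have h1 : ∑ t ∈ Finset.Icc 1 n, ((t - 1).factorial : ℝ) * (-c) ^ (n + 1 - t)
      = -∑ t ∈ Finset.Icc 1 n, c * (((t - 1).factorial : ℝ) * (-c) ^ (n - t)) := by
    rw [← Finset.sum_neg_distrib]
    refine Finset.sum_congr rfl fun t ht => ?_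
    rw [Nat.succ_sub (Finset.mem_Icc.1 ht).2, pow_succ]
    ring
  have h2 : (-1 : ℝ) ^ (((n + 1 : ℕ) : ℤ) - 1) = -(-1 : ℝ) ^ ((n : ℤ) - 1) := by
    rw [show ((n + 1 : ℕ) : ℤ) - 1 = ((n : ℤ) - 1) + 1 by push_cast; ring,
      zpow_add_one₀ (by norm_num)]
    ring
  rw [h1, h2, Nat.sub_self, pow_zero, Nat.add_sub_cancel, pow_succ (1 / c)]
  field_simp
  ring

theorem eiBlock_eq_integral {c : ℝ} (hc : 0 < c) (n : ℕ) :
    Params.eiBlock c n = ∫ v in Set.Ioi (0 : ℝ), v ^ n * Real.exp (-v) / (v + c) := by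
  induction n with
  | zero =>
    simp only [pow_zero, one_mul]
    rw [← exp_mul_neg_Ei]
    -- The finite sum is empty, and the integer exponent gives the sign (-1)^(-1) = -1.
    simp [Params.eiBlock]
  | succ n ih =>
    rw [eiBlock_succ hc, ih, ← integral_pow_mul_exp_neg, ← integral_const_mul,
      ← integral_sub (integrableOn_pow_mul_exp_neg n)
        ((integrableOn_pow_mul_exp_neg_div hc n).const_mul c)]
    refine setIntegral_congr_fun measurableSet_Ioi fun v (hv : 0 < v) => ?_
    have : v + c ≠ 0 := by positivity
    field_simp
    ring

theorem hasDerivAt_log_one_add_div {c v : ℝ} (hc : 0 < c) (hv : 0 ≤ v) :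
    HasDerivAt (fun v : ℝ => Real.log (1 + v / c)) (1 / (v + c)) v := by
  refine ((((hasDerivAt_id v).div_const c).const_add 1).log
    (by simp only [id]; positivity)).congr_deriv ?_
  simp only [id]
  field_simp
  ring

theorem integral_log_mul_exp_neg {c : ℝ} (hc : 0 < c) :
    ∫ v in Set.Ioi (0 : ℝ), Real.log (1 + v / c) * (v ^ 0 * Real.exp (-v))
      = Params.eiBlock c 0 := by
  have h1 := integrableOn_pow_mul_exp_neg_div hc 0
  have h2 := integrableOn_log_mul_pow_mul_exp_neg hc 0
  have h := integral_Ioi_of_hasDerivAt_of_tendsto'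
    (f := fun v => Real.log (1 + v / c) * (v ^ 0 * Real.exp (-v)))
    (f' := fun v => v ^ 0 * Real.exp (-v) / (v + c)
      - Real.log (1 + v / c) * (v ^ 0 * Real.exp (-v))) (a := 0)
    (fun v hv => by
      simp only [pow_zero, one_mul]
      refine ((hasDerivAt_log_one_add_div hc hv).mul (hasDerivAt_neg v).exp).congr_deriv ?_
      ring) (h1.sub h2) (tendsto_log_mul_pow_mul_exp_neg hc 0)
  rw [integral_sub h1 h2, ← eiBlock_eq_integral hc] at h
  simp only [zero_div, add_zero, Real.log_one, zero_mul, sub_zero] at h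
  linarith

/-- Integration by parts; the boundary terms vanish at 0 through the logarithm and at infinity
through the exponential. -/
theorem integral_log_mul_pow_succ_mul_exp_neg {c : ℝ} (hc : 0 < c) (n : ℕ) :
    ∫ v in Set.Ioi (0 : ℝ), Real.log (1 + v / c) * (v ^ (n + 1) * Real.exp (-v))
      = Params.eiBlock c (n + 1)
        + (n + 1) * ∫ v in Set.Ioi (0 : ℝ), Real.log (1 + v / c) * (v ^ n * Real.exp (-v)) := by
  have h1 := integrableOn_pow_mul_exp_neg_div hc (n + 1)
  have h2 := integrableOn_log_mul_pow_mul_exp_neg hc (n + 1)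
  have h3 := (integrableOn_log_mul_pow_mul_exp_neg hc n).const_mul ((n : ℝ) + 1)
  have h13 : IntegrableOn (fun v => v ^ (n + 1) * Real.exp (-v) / (v + c)
      + (n + 1) * (Real.log (1 + v / c) * (v ^ n * Real.exp (-v)))) (Set.Ioi 0) := h1.add h3
  have h := integral_Ioi_of_hasDerivAt_of_tendsto'
    (f := fun v => Real.log (1 + v / c) * (v ^ (n + 1) * Real.exp (-v)))
    (f' := fun v => v ^ (n + 1) * Real.exp (-v) / (v + c)
      + (n + 1) * (Real.log (1 + v / c) * (v ^ n * Real.exp (-v)))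
      - Real.log (1 + v / c) * (v ^ (n + 1) * Real.exp (-v))) (a := 0)
    (fun v hv => by
      refine ((hasDerivAt_log_one_add_div hc hv).mul
        ((hasDerivAt_pow (n + 1) v).mul (hasDerivAt_neg v).exp)).congr_deriv ?_
      push_cast
      simp only [Pi.mul_apply]
      ring) (h13.sub h2) (tendsto_log_mul_pow_mul_exp_neg hc (n + 1))
  rw [integral_sub h13 h2, integral_add h1 h3, ← eiBlock_eq_integral hc,
    integral_const_mul] at h
  simp only [zero_div, add_zero, Real.log_one, zero_mul, sub_zero] at h
  linarith

theorem integral_log_mul_pow_mul_exp_neg {c : ℝ} (hc : 0 < c) (n : ℕ) :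
    ∫ v in Set.Ioi (0 : ℝ), Real.log (1 + v / c) * (v ^ n * Real.exp (-v))
      = (n.factorial : ℝ)
        * ∑ q ∈ Finset.range (n + 1), 1 / (q.factorial : ℝ) * Params.eiBlock c q := by
  induction n with
  | zero => rw [integral_log_mul_exp_neg hc]; simp
  | succ n ih =>
    rw [integral_log_mul_pow_succ_mul_exp_neg hc, ih, Finset.sum_range_succ _ (n + 1),
      Nat.factorial_succ]
    push_cast
    field_simp
    ring

/-- The previous formula for the shape `m ≥ 1`, summed in the reverse order. -/
theorem integral_log_mul_pow_pred_mul_exp_neg {c : ℝ} (hc : 0 < c) {m : ℕ} (hm : 1 ≤ m) :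
    ∫ v in Set.Ioi (0 : ℝ), Real.log (1 + v / c) * (v ^ (m - 1) * Real.exp (-v))
      = ((m - 1).factorial : ℝ) * ∑ q ∈ Finset.range m,
        1 / ((m - q - 1).factorial : ℝ) * Params.eiBlock c (m - q - 1) := by
  rw [integral_log_mul_pow_mul_exp_neg hc, Nat.sub_add_cancel hm, ← Finset.sum_range_reflect]
  congr 1
  refine Finset.sum_congr rfl fun q _ => ?_
  rw [show m - 1 - q = m - q - 1 by omega]

/-! ### Gamma laws: rescaling, exponential tilting and moments. -/

theorem gammaPDFReal_mul_rate {a θ : ℝ} (hθ : 0 < θ) (x : ℝ) :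
    gammaPDFReal a (1 / θ) x = θ⁻¹ * gammaPDFReal a 1 (θ⁻¹ * x) := by
  unfold gammaPDFReal
  have hi : 0 < θ⁻¹ := by positivity
  by_cases hx : 0 ≤ x
  · rw [if_pos hx, if_pos (by positivity), one_div, Real.one_rpow, Real.mul_rpow hi.le hx,
      Real.rpow_sub_one hi.ne', one_mul]
    field_simp
  · rw [if_neg hx, if_neg (by rw [mul_nonneg_iff_of_pos_left hi]; exact hx), mul_zero]

theorem measurable_gammaPDF (a r : ℝ) : Measurable (gammaPDF a r) :=
  (measurable_gammaPDFReal a r).ennreal_ofReal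

theorem map_gammaMeasure {a θ : ℝ} (hθ : 0 < θ) :
    (gammaMeasure a (1 / θ)).map (fun x => θ⁻¹ * x) = gammaMeasure a 1 := by
  have hi : 0 < θ⁻¹ := by positivity
  have hm : Measurable fun x : ℝ => θ⁻¹ * x := by fun_prop
  ext s hs
  rw [Measure.map_apply hm hs, gammaMeasure, gammaMeasure, withDensity_apply _ (hm hs),
    withDensity_apply _ hs]
  -- Lebesgue measure is θ⁻¹ times its image under multiplication by θ⁻¹, which is the factor
  -- relating the two densities.
  conv_rhs => rw [← Real.smul_map_volume_mul_left hi.ne', Measure.restrict_smul,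
    lintegral_smul_measure, setLIntegral_map hs (measurable_gammaPDF a 1) hm]
  rw [smul_eq_mul, ← lintegral_const_mul _ (f := fun x => gammaPDF a 1 (θ⁻¹ * x))
    ((measurable_gammaPDF a 1).comp hm)]
  refine lintegral_congr fun x => ?_
  rw [gammaPDF, gammaPDF, gammaPDFReal_mul_rate hθ, ENNReal.ofReal_mul hi.le, abs_of_pos hi]

theorem gammaPDFReal_one_of_nonneg {k : ℕ} (hk : 1 ≤ k) {x : ℝ} (hx : 0 ≤ x) :
    gammaPDFReal k 1 x = ((k - 1).factorial : ℝ)⁻¹ * (x ^ (k - 1) * Real.exp (-x)) := by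
  obtain ⟨n, rfl⟩ : ∃ n, k = n + 1 := ⟨k - 1, by omega⟩
  rw [gammaPDFReal, if_pos hx, Real.one_rpow, one_mul, Nat.add_sub_cancel]
  push_cast
  rw [Real.Gamma_nat_eq_factorial, add_sub_cancel_right, Real.rpow_natCast]
  field_simp

theorem gammaPDFReal_smul_eq_indicator {k : ℕ} (hk : 1 ≤ k) (f : ℝ → ℝ) :
    (fun x => (gammaPDF k 1 x).toReal • f x) = (Set.Ici 0).indicator
      fun x => ((k - 1).factorial : ℝ)⁻¹ * (f x * (x ^ (k - 1) * Real.exp (-x))) := by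
  have hk0 : (0 : ℝ) < k := by exact_mod_cast hk
  funext x
  rw [gammaPDF, ENNReal.toReal_ofReal (gammaPDFReal_nonneg hk0 one_pos x), smul_eq_mul]
  by_cases hx : x ∈ Set.Ici (0 : ℝ)
  · rw [Set.indicator_of_mem hx, gammaPDFReal_one_of_nonneg hk hx]
    ring
  · rw [Set.indicator_of_notMem hx, gammaPDFReal, if_neg (by simpa using hx), zero_mul]

theorem integral_gammaMeasure {k : ℕ} (hk : 1 ≤ k) (f : ℝ → ℝ) :
    ∫ y, f y ∂(gammaMeasure k 1) = ((k - 1).factorial : ℝ)⁻¹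
      * ∫ y in Set.Ioi (0 : ℝ), f y * (y ^ (k - 1) * Real.exp (-y)) := by
  rw [gammaMeasure, integral_withDensity_eq_integral_toReal_smul
    (measurable_gammaPDF _ 1) (.of_forall fun _ => ENNReal.ofReal_lt_top),
    gammaPDFReal_smul_eq_indicator hk, integral_indicator measurableSet_Ici,
    integral_Ici_eq_integral_Ioi, integral_const_mul]

theorem integrable_gammaMeasure {k : ℕ} (hk : 1 ≤ k) {f : ℝ → ℝ}
    (hf : IntegrableOn (fun y => f y * (y ^ (k - 1) * Real.exp (-y))) (Set.Ioi 0)) :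
    Integrable f (gammaMeasure k 1) := by
  rw [gammaMeasure, integrable_withDensity_iff_integrable_smul'
    (measurable_gammaPDF _ 1) (.of_forall fun _ => ENNReal.ofReal_lt_top),
    gammaPDFReal_smul_eq_indicator hk, integrable_indicator_iff measurableSet_Ici,
    integrableOn_Ici_iff_integrableOn_Ioi]
  exact hf.const_mul _

theorem ae_nonneg_gammaMeasure (a r : ℝ) : ∀ᵐ y ∂(gammaMeasure a r), 0 ≤ y := by
  rw [gammaMeasure, ae_withDensity_iff (measurable_gammaPDF _ _)]
  refine .of_forall fun y hy => ?_
  by_contra h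
  exact hy (gammaPDF_of_neg (not_le.1 h))

/-- The factor e^(-(b-1)y) turns the weight e^(-y) into e^(-by), so the substitution v = by reduces
every tilted Gamma expectation to a half-line integral of shape k + n. -/
theorem tilt_density_eq {k : ℕ} (hk : 1 ≤ k) (n : ℕ) {b : ℝ} (hb : 0 < b) (f : ℝ → ℝ) (y : ℝ) :
    f (b * y) * (y ^ n * Real.exp (-((b - 1) * y))) * (y ^ (k - 1) * Real.exp (-y))
      = (b ^ (k + n - 1))⁻¹ *
        (f (b * y) * ((b * y) ^ (k + n - 1) * Real.exp (-(b * y)))) := by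
  rw [show Real.exp (-(b * y)) = Real.exp (-((b - 1) * y)) * Real.exp (-y) by
    rw [← Real.exp_add]; ring_nf, mul_pow, show k + n - 1 = n + (k - 1) by omega, pow_add y]
  field_simp

theorem integrable_gammaMeasure_tilt {k : ℕ} (hk : 1 ≤ k) (n : ℕ) {b : ℝ} (hb : 0 < b)
    {f : ℝ → ℝ}
    (hf : IntegrableOn (fun v => f v * (v ^ (k + n - 1) * Real.exp (-v))) (Set.Ioi 0)) :
    Integrable (fun y => f (b * y) * (y ^ n * Real.exp (-((b - 1) * y)))) (gammaMeasure k 1) := by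
  refine integrable_gammaMeasure hk ?_
  simp_rw [tilt_density_eq hk n hb]
  refine Integrable.const_mul ?_ _
  have := (integrableOn_Ioi_comp_mul_left_iff
    (fun v => f v * (v ^ (k + n - 1) * Real.exp (-v))) 0 hb).2
  rw [mul_zero] at this
  exact this hf

theorem integral_gammaMeasure_tilt {k : ℕ} (hk : 1 ≤ k) (n : ℕ) {b : ℝ} (hb : 0 < b)
    (f : ℝ → ℝ) :
    ∫ y, f (b * y) * (y ^ n * Real.exp (-((b - 1) * y))) ∂(gammaMeasure k 1)
      = (((k - 1).factorial : ℝ) * b ^ (k + n))⁻¹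
        * ∫ v in Set.Ioi (0 : ℝ), f v * (v ^ (k + n - 1) * Real.exp (-v)) := by
  rw [integral_gammaMeasure hk]
  simp_rw [tilt_density_eq hk n hb]
  rw [integral_const_mul, integral_comp_mul_left_Ioi
    (fun v => f v * (v ^ (k + n - 1) * Real.exp (-v))) 0 hb, mul_zero, smul_eq_mul,
    ← mul_assoc, ← mul_assoc]
  congr 1
  obtain ⟨m, hm⟩ : ∃ m, k + n = m + 1 := ⟨k + n - 1, by omega⟩
  rw [hm, Nat.add_sub_cancel, pow_succ, mul_inv, mul_inv, mul_assoc]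

theorem poch_natCast {k : ℕ} (hk : 1 ≤ k) (n : ℕ) :
    poch k n = ((k + n - 1).factorial : ℝ) / ((k - 1).factorial : ℝ) := by
  obtain ⟨m, rfl⟩ : ∃ m, k = m + 1 := ⟨k - 1, by omega⟩
  rw [eq_div_iff (by positivity), poch, ascPochhammer_nat_eq_natCast_ascFactorial, mul_comm]
  have := Nat.factorial_mul_ascFactorial m n
  rw [show m + 1 + n - 1 = m + n by omega, Nat.add_sub_cancel, ← this]
  push_cast
  rfl

theorem integrable_pow_mul_exp_gammaMeasure {k : ℕ} (hk : 1 ≤ k) (n : ℕ) {s : ℝ} (hs : -1 < s) :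
    Integrable (fun y => y ^ n * Real.exp (-(s * y))) (gammaMeasure k 1) := by
  have := integrable_gammaMeasure_tilt hk n (b := 1 + s) (by linarith) (f := fun _ => 1)
    (by simpa using integrableOn_pow_mul_exp_neg (k + n - 1))
  simpa using this

theorem integral_pow_mul_exp_gammaMeasure {k : ℕ} (hk : 1 ≤ k) (n : ℕ) {s : ℝ} (hs : -1 < s) :
    ∫ y, y ^ n * Real.exp (-(s * y)) ∂(gammaMeasure k 1) = poch k n / (1 + s) ^ (k + n) := by
  have := integral_gammaMeasure_tilt hk n (b := 1 + s) (by linarith) (fun _ => 1)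
  simp only [one_mul, add_sub_cancel_left, integral_pow_mul_exp_neg] at this
  rw [this, poch_natCast hk]
  field_simp

theorem integrable_pow_gammaMeasure {k : ℕ} (hk : 1 ≤ k) (n : ℕ) :
    Integrable (fun y => y ^ n) (gammaMeasure k 1) := by
  simpa using integrable_pow_mul_exp_gammaMeasure hk n (s := 0) (by norm_num)

theorem integral_pow_gammaMeasure {k : ℕ} (hk : 1 ≤ k) (n : ℕ) :
    ∫ y, y ^ n ∂(gammaMeasure k 1) = poch k n := by
  simpa using integral_pow_mul_exp_gammaMeasure hk n (s := 0) (by norm_num)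

theorem integrable_log_gammaMeasure {k : ℕ} (hk : 1 ≤ k) (n : ℕ) {c s : ℝ} (hc : 0 < c)
    (hs : -1 < s) : Integrable (fun y => Real.log (1 + y / c) * (y ^ n * Real.exp (-(s * y))))
      (gammaMeasure k 1) := by
  have hs' : 0 < 1 + s := by linarith
  have := integrable_gammaMeasure_tilt hk n hs' (f := fun v => Real.log (1 + v / (c * (1 + s))))
    (integrableOn_log_mul_pow_mul_exp_neg (by positivity) _)
  simp_rw [mul_comm c, mul_div_mul_left _ _ hs'.ne', add_sub_cancel_left] at this
  exact this

theorem integral_log_gammaMeasure {k : ℕ} (hk : 1 ≤ k) (n : ℕ) {c s : ℝ} (hc : 0 < c)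
    (hs : -1 < s) :
    ∫ y, Real.log (1 + y / c) * (y ^ n * Real.exp (-(s * y))) ∂(gammaMeasure k 1)
      = (((k - 1).factorial : ℝ) * (1 + s) ^ (k + n))⁻¹ * (((k + n - 1).factorial : ℝ)
        * ∑ e ∈ Finset.range (k + n), 1 / ((k + n - e - 1).factorial : ℝ)
          * Params.eiBlock (c * (1 + s)) (k + n - e - 1)) := by
  have hs' : 0 < 1 + s := by linarith
  have := integral_gammaMeasure_tilt hk n hs' (fun v => Real.log (1 + v / (c * (1 + s))))
  rw [integral_log_mul_pow_pred_mul_exp_neg (by positivity) (by omega)] at this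
  simp_rw [mul_comm c, mul_div_mul_left _ _ hs'.ne', add_sub_cancel_left] at this
  rw [this, mul_comm c]

theorem add_mul_pow_eq_sum (τ w y : ℝ) (m : ℕ) :
    (τ + w * y) ^ m = ∑ f ∈ Finset.range (m + 1), (m.choose f : ℝ) * τ ^ (m - f) * w ^ f * y ^ f := by
  rw [add_comm, add_pow]
  refine Finset.sum_congr rfl fun f _ => ?_
  rw [mul_pow]
  ring

theorem integrable_affine_pow_mul_exp {k : ℕ} (hk : 1 ≤ k) (m : ℕ) (τ w : ℝ) {s : ℝ}
    (hs : -1 < s) :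
    Integrable (fun y => (τ + w * y) ^ m * Real.exp (-(s * y))) (gammaMeasure k 1) := by
  simp_rw [add_mul_pow_eq_sum, Finset.sum_mul, mul_assoc _ (_ ^ _) (Real.exp _)]
  exact integrable_finsetSum _ fun f _ => (integrable_pow_mul_exp_gammaMeasure hk f hs).const_mul _

theorem integrable_affine_pow {k : ℕ} (hk : 1 ≤ k) (m : ℕ) (τ w : ℝ) :
    Integrable (fun y => (τ + w * y) ^ m) (gammaMeasure k 1) := by
  simpa using integrable_affine_pow_mul_exp hk m τ w (s := 0) (by norm_num)

theorem integral_affine_pow {k : ℕ} (hk : 1 ≤ k) (m : ℕ) (τ w : ℝ) :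
    ∫ y, (τ + w * y) ^ m ∂(gammaMeasure k 1)
      = ∑ f ∈ Finset.range (m + 1), (m.choose f : ℝ) * τ ^ (m - f) * w ^ f * poch k f := by
  simp_rw [add_mul_pow_eq_sum]
  rw [integral_finsetSum _ fun f _ => (integrable_pow_gammaMeasure hk f).const_mul _]
  simp_rw [integral_const_mul, integral_pow_gammaMeasure hk]

theorem integrable_gammaSeries_affine {k κ : ℕ} (hk : 1 ≤ k) (hκ : 1 ≤ κ) {τ w : ℝ} (hτ : 0 < τ)
    (hw : 0 < w) (r : ℕ) :
    Integrable (fun y => gammaSeries κ r (τ + w * y)) (gammaMeasure k 1) := by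
  refine ((integrable_affine_pow hk κ τ w).div_const ((κ : ℝ) ^ r)).mono' ?_ ?_
  · have := continuous_gammaSeries hκ r
    exact (by fun_prop : Continuous fun y => gammaSeries κ r (τ + w * y)).aestronglyMeasurable
  · filter_upwards [ae_nonneg_gammaMeasure k 1] with y hy
    have hz : 0 ≤ τ + w * y := by positivity
    rw [Real.norm_of_nonneg (gammaSeries_nonneg hκ r hz)]
    exact gammaSeries_le hκ r hz

/-! ### Convergence and value of the infinite series. -/

namespace Params

variable (p : Params)

theorem seriesTerm_eq_integral (hk : 1 ≤ p.k) (κ j : ℕ) :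
    p.seriesTerm κ j = (-1) ^ j / ((j.factorial : ℝ) * ((κ : ℝ) + j) ^ 2)
      * ∫ y, (p.τ2 + p.θe * p.ψ * y) ^ (κ + j) ∂(gammaMeasure p.k 1) := by
  rw [integral_affine_pow hk, Finset.mul_sum, seriesTerm]
  refine Finset.sum_congr rfl fun f _ => ?_
  ring

/-- The moment of order m = κ + j is at least its top binomial term w^m (k)_m, and (k)_m ≥ m! ≥ m
j!; the factor m² in the denominator leaves w^m/m. -/
theorem pow_div_le_abs_seriesTerm (hk : 1 ≤ p.k) {κ : ℕ} (hκ : 1 ≤ κ) (hτ : 0 < p.τ2)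
    (hw : 0 < p.θe * p.ψ) (j : ℕ) :
    (p.θe * p.ψ) ^ (κ + j) / ((κ + j : ℕ) : ℝ) ≤ |p.seriesTerm κ j| := by
  set w := p.θe * p.ψ
  have hκ0 : (0 : ℝ) < κ := by exact_mod_cast hκ
  have hpoch : ∀ n, 0 ≤ poch p.k n := fun n => by rw [poch_natCast hk]; positivity
  have h1 : w ^ (κ + j) * poch p.k (κ + j)
      ≤ ∫ y, (p.τ2 + w * y) ^ (κ + j) ∂(gammaMeasure p.k 1) := by
    rw [integral_affine_pow hk]
    refine le_trans (le_of_eq ?_) (Finset.single_le_sum (fun f _ => ?_)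
      (Finset.self_mem_range_succ (κ + j)))
    · simp
    · have := hpoch f
      positivity
  have h2 : (((κ + j : ℕ) : ℝ) * (j.factorial : ℝ)) ≤ poch p.k (κ + j) := by
    rw [poch_natCast hk, le_div_iff₀ (by positivity)]
    have h3 : (κ + j) * j.factorial ≤ (κ + j).factorial := by
      rw [← Nat.mul_factorial_pred (by omega : κ + j ≠ 0)]
      exact Nat.mul_le_mul_left _ (Nat.factorial_le (by omega))
    have h4 := Nat.le_of_dvd (Nat.factorial_pos _)
      (Nat.factorial_mul_factorial_dvd_factorial_add (κ + j) (p.k - 1))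
    rw [show κ + j + (p.k - 1) = p.k + (κ + j) - 1 by omega] at h4
    exact_mod_cast (Nat.mul_le_mul_right _ h3).trans h4
  have h5 : 0 < ((κ : ℝ) + j) := by positivity
  have hj : (0 : ℝ) < j.factorial := by positivity
  have h6 : 0 ≤ w ^ (κ + j) * poch p.k (κ + j) := mul_nonneg (by positivity) (hpoch _)
  rw [seriesTerm_eq_integral p hk, abs_mul, abs_div, abs_pow, abs_neg, abs_one, one_pow,
    abs_of_nonneg (h6.trans h1), abs_of_pos (by positivity)]
  calc w ^ (κ + j) / ((κ + j : ℕ) : ℝ)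
      = 1 / ((j.factorial : ℝ) * ((κ : ℝ) + j) ^ 2)
        * (w ^ (κ + j) * (((κ + j : ℕ) : ℝ) * (j.factorial : ℝ))) := by
        push_cast; field_simp
    _ ≤ 1 / ((j.factorial : ℝ) * ((κ : ℝ) + j) ^ 2) * (w ^ (κ + j) * poch p.k (κ + j)) := by gcongr
    _ ≤ _ := by gcongr

/-- The absolute partial sums are at most z^κ e^(rz) with z = τ2 + wy, whose expectation is finite
exactly because rw < 1. -/
theorem hasSum_seriesTerm_mul_pow (hk : 1 ≤ p.k) {κ : ℕ} (hκ : 1 ≤ κ) (hτ : 0 < p.τ2)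
    (hw : 0 < p.θe * p.ψ) {r : ℝ} (hr : 0 < r) (hrw : r * (p.θe * p.ψ) < 1) :
    HasSum (fun j => p.seriesTerm κ j * r ^ j)
      (∫ y, gammaSeries κ 2 (r * (p.τ2 + p.θe * p.ψ * y)) / r ^ κ ∂(gammaMeasure p.k 1)) := by
  set w := p.θe * p.ψ
  set τ := p.τ2
  set F : ℕ → ℝ → ℝ := fun j y =>
    (-1) ^ j / ((j.factorial : ℝ) * ((κ : ℝ) + j) ^ 2) * r ^ j * (τ + w * y) ^ (κ + j) with hF
  have hFi : ∀ j, Integrable (F j) (gammaMeasure p.k 1) := fun j =>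
    (integrable_affine_pow hk (κ + j) τ w).const_mul _
  have hexp : Integrable (fun y => (τ + w * y) ^ κ * Real.exp (r * (τ + w * y)))
      (gammaMeasure p.k 1) := by
    have := (integrable_affine_pow_mul_exp hk κ τ w (s := -(r * w)) (by linarith)).const_mul
      (Real.exp (r * τ))
    refine this.congr (.of_forall fun y => ?_)
    simp only
    rw [mul_left_comm, ← Real.exp_add]
    ring_nf
  have hbound : ∀ y, 0 ≤ y → ∀ J, ∑ j ∈ Finset.range J, ‖F j y‖
      ≤ (τ + w * y) ^ κ * Real.exp (r * (τ + w * y)) := fun y hy J => by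
    have hz : 0 ≤ τ + w * y := by positivity
    calc ∑ j ∈ Finset.range J, ‖F j y‖
        ≤ ∑ j ∈ Finset.range J, (τ + w * y) ^ κ * ((r * (τ + w * y)) ^ j / (j.factorial : ℝ)) := by
          refine Finset.sum_le_sum fun j _ => ?_
          have h1 := one_le_add_pow hκ j 2
          have hj : (0 : ℝ) < j.factorial := by positivity
          rw [hF, Real.norm_eq_abs, abs_mul, abs_mul, abs_div, abs_pow (-1 : ℝ), abs_neg, abs_one,
            one_pow, abs_of_nonneg (by positivity : 0 ≤ r ^ j),
            abs_of_nonneg (by positivity : 0 ≤ (τ + w * y) ^ (κ + j)),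
            abs_of_pos (by positivity)]
          calc 1 / ((j.factorial : ℝ) * ((κ : ℝ) + j) ^ 2) * r ^ j * (τ + w * y) ^ (κ + j)
              ≤ 1 / (j.factorial : ℝ) * r ^ j * (τ + w * y) ^ (κ + j) := by
                gcongr
                exact le_mul_of_one_le_right hj.le h1
            _ = _ := by rw [pow_add, mul_pow]; ring
      _ = (τ + w * y) ^ κ * ∑ j ∈ Finset.range J, (r * (τ + w * y)) ^ j / (j.factorial : ℝ) := by
          rw [Finset.mul_sum]
      _ ≤ _ := by
          gcongr
          exact Real.sum_le_exp_of_nonneg (by positivity) J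
  have hsum : Summable fun j => ∫ y, ‖F j y‖ ∂(gammaMeasure p.k 1) := by
    refine summable_of_sum_range_le (c := ∫ y, (τ + w * y) ^ κ * Real.exp (r * (τ + w * y))
      ∂(gammaMeasure p.k 1)) (fun j => integral_nonneg fun y => norm_nonneg _) fun J => ?_
    rw [← integral_finsetSum _ fun j _ => (hFi j).norm]
    refine integral_mono_ae (integrable_finsetSum _ fun j _ => (hFi j).norm) hexp ?_
    filter_upwards [ae_nonneg_gammaMeasure p.k 1] with y hy
    exact hbound y hy J
  have h := hasSum_integral_of_summable_integral_norm hFi hsum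
  convert! h using 1
  · funext j
    rw [hF, integral_const_mul, seriesTerm_eq_integral p hk]
    ring
  · congr 1
    funext y
    rw [gammaSeries, ← tsum_div_const]
    refine tsum_congr fun j => ?_
    rw [hF, mul_pow, pow_add r]
    field_simp

theorem summable_seriesTerm_iff (hk : 1 ≤ p.k) {κ : ℕ} (hκ : 1 ≤ κ) (hτ : 0 < p.τ2)
    (hw : 0 < p.θe * p.ψ) : Summable (p.seriesTerm κ) ↔ p.θe * p.ψ < 1 := by
  refine ⟨fun h => ?_, fun h => ?_⟩
  · by_contra! hw1
    -- For w ≥ 1 the lower bound dominates a tail of the harmonic series.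
    refine Real.not_summable_natCast_inv ((summable_nat_add_iff κ).1 ?_)
    refine Summable.of_nonneg_of_le (fun j => by positivity) (fun j => ?_) h.abs
    refine le_trans ?_ (p.pow_div_le_abs_seriesTerm hk hκ hτ hw j)
    rw [inv_eq_one_div, add_comm j]
    gcongr
    exact one_le_pow₀ hw1
  · simpa using (p.hasSum_seriesTerm_mul_pow hk hκ hτ hw one_pos
      (by simpa using h)).summable

theorem le_one_of_tendsto_seriesTerm (hk : 1 ≤ p.k) {κ : ℕ} (hκ : 1 ≤ κ) (hτ : 0 < p.τ2)
    (hw : 0 < p.θe * p.ψ) (h : Tendsto (p.seriesTerm κ) atTop (𝓝 0)) : p.θe * p.ψ ≤ 1 := by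
  by_contra! hw1
  have h1 : p.θe * p.ψ - 1 ≤ |(0 : ℝ)| := by
    -- Bernoulli's inequality gives w^m/m ≥ w - 1 for m = κ + j, so the terms stay away from 0 when
    -- w > 1.
    refine ge_of_tendsto' h.abs fun j => le_trans ?_ (p.pow_div_le_abs_seriesTerm hk hκ hτ hw j)
    have hm : (0 : ℝ) < ((κ + j : ℕ) : ℝ) := by exact_mod_cast (by omega : 0 < κ + j)
    rw [le_div_iff₀ hm]
    have := one_add_mul_sub_le_pow (a := p.θe * p.ψ) (by linarith) (κ + j)
    linarith
  rw [abs_zero] at h1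
  linarith

/-- The value of the series, whenever it converges, by Abel's limit theorem. -/
theorem eq_integral_of_tendsto_seriesTerm (hk : 1 ≤ p.k) {κ : ℕ} (hκ : 1 ≤ κ) (hτ : 0 < p.τ2)
    (hw : 0 < p.θe * p.ψ) {S : ℝ}
    (h : Tendsto (fun J : ℕ => ∑ j ∈ Finset.range J, p.seriesTerm κ j) atTop (𝓝 S)) :
    S = ∫ y, gammaSeries κ 2 (p.τ2 + p.θe * p.ψ * y) ∂(gammaMeasure p.k 1) := by
  have hterm : Tendsto (p.seriesTerm κ) atTop (𝓝 0) := by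
    have := (h.comp (tendsto_add_atTop_nat 1)).sub h
    simpa [Function.comp_def, Finset.sum_range_succ] using this
  have hw1 := p.le_one_of_tendsto_seriesTerm hk hκ hτ hw hterm
  have hI : ∀ᶠ r : ℝ in 𝓝[<] 1, r ∈ Set.Ioo (0 : ℝ) 1 := Ioo_mem_nhdsLT one_pos
  refine tendsto_nhds_unique (Real.tendsto_tsum_powerSeries_nhdsWithin_lt h) ?_
  have hlim : Tendsto (fun r : ℝ => ∫ y, gammaSeries κ 2 (r * (p.τ2 + p.θe * p.ψ * y)) / r ^ κ
      ∂(gammaMeasure p.k 1)) (𝓝[<] 1)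
      (𝓝 (∫ y, gammaSeries κ 2 (p.τ2 + p.θe * p.ψ * y) ∂(gammaMeasure p.k 1))) := by
    have hc := continuous_gammaSeries hκ 2
    refine tendsto_integral_filter_of_dominated_convergence
      -- In G_2(rz)/r^κ ≤ (rz)^κ/(κ² r^κ) the powers of r cancel, so the majorant does not depend on
      -- r.
      (fun y => (p.τ2 + p.θe * p.ψ * y) ^ κ / (κ : ℝ) ^ 2) ?_ ?_
      ((integrable_affine_pow hk κ _ _).div_const _) ?_
    · exact .of_forall fun r => (by fun_prop : Continuous fun y =>
        gammaSeries κ 2 (r * (p.τ2 + p.θe * p.ψ * y)) / r ^ κ).aestronglyMeasurable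
    · filter_upwards [hI] with r hr
      filter_upwards [ae_nonneg_gammaMeasure p.k 1] with y hy
      have hr0 := hr.1
      have hz : 0 ≤ r * (p.τ2 + p.θe * p.ψ * y) := by positivity
      rw [Real.norm_of_nonneg (div_nonneg (gammaSeries_nonneg hκ 2 hz) (by positivity)),
        div_le_iff₀ (by positivity)]
      refine (gammaSeries_le hκ 2 hz).trans (le_of_eq ?_)
      rw [mul_pow]
      ring
    · refine .of_forall fun y => ?_
      have : ContinuousAt (fun r : ℝ =>
          gammaSeries κ 2 (r * (p.τ2 + p.θe * p.ψ * y)) / r ^ κ) 1 := by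
        fun_prop (disch := simp)
      simpa using this.tendsto.mono_left nhdsWithin_le_nhds
  refine hlim.congr' ?_
  filter_upwards [hI] with r hr
  refine (p.hasSum_seriesTerm_mul_pow hk hκ hτ hw hr.1 ?_).tsum_eq.symm
  nlinarith [hr.1, hr.2]

end Params

/-! ### The finite sums as expectations over the secondary gain. -/

namespace Params

variable (p : Params)

/-- The expectation of `log (1 + w Y / τ) Y^n e^{-wY}`, for `Y` of the Gamma law of shape `k`. -/
def logMoment (n : ℕ) : ℝ :=
  ∫ y, Real.log (1 + y / (p.τ2 / (p.θe * p.ψ))) * (y ^ n * Real.exp (-(p.θe * p.ψ * y)))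
    ∂(gammaMeasure p.k 1)

/-- The coefficients of the expansion of `(κ-1)! e^{-z} ∑_{a<κ} z^a / a!` at `z = τ + w y` in terms
of `y^n e^{-wy}`. -/
def gammaCoeff (κ a n : ℕ) : ℝ :=
  ((κ - 1).factorial : ℝ) * Real.exp (-p.τ2)
    * ((a.choose n : ℝ) * p.τ2 ^ (a - n) * (p.θe * p.ψ) ^ n / (a.factorial : ℝ))

/-- Since (k)_n = Γ(k+n)/Γ(k), the log(1/τ2) terms of `sumC` cancel the log τ2 terms of `sumB`; what
remains is the logarithmic moment. -/
theorem sumB_add_sumC (hk : 1 ≤ p.k) (hτ : 0 < p.τ2) (hw : 0 < p.θe * p.ψ) (κ : ℕ) :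
    p.sumB κ + p.sumC κ
      = ∑ a ∈ Finset.range κ, ∑ n ∈ Finset.range (a + 1), p.gammaCoeff κ a n * p.logMoment n := by
  rw [sumB, sumC, ← Finset.sum_add_distrib]
  refine Finset.sum_congr rfl fun a _ => ?_
  rw [← Finset.sum_add_distrib]
  refine Finset.sum_congr rfl fun n _ => ?_
  have hΓ : Real.Gamma ((p.k : ℝ) + n) = ((p.k + n - 1).factorial : ℝ) := by
    rw [← Real.Gamma_nat_eq_factorial]
    congr 1
    rw [Nat.cast_sub (by omega)]
    push_cast
    ring
  have hΓk : Real.Gamma (p.k : ℝ) = ((p.k - 1).factorial : ℝ) := by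
    rw [← Real.Gamma_nat_eq_factorial]
    congr 1
    rw [Nat.cast_sub (by omega)]
    push_cast
    ring
  rw [logMoment, integral_log_gammaMeasure hk n (by positivity) (by linarith), poch_natCast hk,
    hΓ, hΓk, one_div p.τ2, Real.log_inv, gammaCoeff,
    show p.τ2 / (p.θe * p.ψ) * (1 + p.θe * p.ψ) = p.τ2 * (p.θe * p.ψ + 1) / (p.θe * p.ψ) by ring,
    add_comm 1 (p.θe * p.ψ), Finset.mul_sum (Finset.range _) _ ((p.k + n - 1).factorial : ℝ)]
  have : ∀ e, ((p.k + n - 1).factorial : ℝ) * (1 / ((p.k + n - e - 1).factorial : ℝ)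
        * eiBlock (p.τ2 * (p.θe * p.ψ + 1) / (p.θe * p.ψ)) (p.k + n - e - 1))
      = ((p.k + n - 1).factorial : ℝ) / ((p.k + n - e - 1).factorial : ℝ)
        * eiBlock (p.τ2 * (p.θe * p.ψ + 1) / (p.θe * p.ψ)) (p.k + n - e - 1) := fun e => by ring
  simp_rw [this]
  field_simp
  ring

theorem sumA_eq_integral (hk : 1 ≤ p.k) (hτ : 0 < p.τ2) (hw : 0 < p.θe * p.ψ) {κ : ℕ}
    (hκ : 1 ≤ κ) :
    p.sumA κ = ((κ - 1).factorial : ℝ)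
      * ∫ y, Real.log (1 + y / (p.τ2 / (p.θe * p.ψ))) ∂(gammaMeasure p.k 1) := by
  have h := integral_log_gammaMeasure hk 0 (c := p.τ2 / (p.θe * p.ψ)) (s := 0) (by positivity)
    (by norm_num)
  simp only [pow_zero, zero_mul, neg_zero, Real.exp_zero, mul_one, add_zero, one_pow] at h
  rw [h, inv_mul_cancel_left₀ (by positivity), sumA, ← Real.Gamma_nat_eq_factorial]
  congr 2
  rw [Nat.cast_sub (by omega)]
  push_cast
  ring

/-- The constant in G_1 = (κ-1)! (1 - e^(-z) ∑ z^a/a!) produces `sumA`, the exponential part `sumB`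
and `sumC`. -/
theorem log_mul_gammaSeries_one_eq (hτ : 0 < p.τ2) (hw : 0 < p.θe * p.ψ) {κ : ℕ} (hκ : 1 ≤ κ)
    {y : ℝ} (hy : 0 ≤ y) :
    Real.log ((p.τ2 + p.θe * p.ψ * y) / p.τ2) * gammaSeries κ 1 (p.τ2 + p.θe * p.ψ * y)
      = ((κ - 1).factorial : ℝ) * Real.log (1 + y / (p.τ2 / (p.θe * p.ψ)))
        - ∑ a ∈ Finset.range κ, ∑ n ∈ Finset.range (a + 1), p.gammaCoeff κ a n *
          (Real.log (1 + y / (p.τ2 / (p.θe * p.ψ)))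
            * (y ^ n * Real.exp (-(p.θe * p.ψ * y)))) := by
  rw [show (p.τ2 + p.θe * p.ψ * y) / p.τ2 = 1 + y / (p.τ2 / (p.θe * p.ψ)) by field_simp,
    gammaSeries_one hκ (by positivity), mul_sub, mul_one, mul_sub, mul_comm (Real.log _)]
  congr 1
  simp_rw [Finset.mul_sum, add_mul_pow_eq_sum, neg_add, Real.exp_add, Finset.sum_div,
    Finset.mul_sum]
  refine Finset.sum_congr rfl fun a _ => Finset.sum_congr rfl fun n _ => ?_
  rw [gammaCoeff]
  ring

theorem integrable_and_integral_log_mul_gammaSeries_one (hk : 1 ≤ p.k) (hτ : 0 < p.τ2)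
    (hw : 0 < p.θe * p.ψ) {κ : ℕ} (hκ : 1 ≤ κ) :
    Integrable (fun y => Real.log ((p.τ2 + p.θe * p.ψ * y) / p.τ2)
        * gammaSeries κ 1 (p.τ2 + p.θe * p.ψ * y)) (gammaMeasure p.k 1) ∧
      ∫ y, Real.log ((p.τ2 + p.θe * p.ψ * y) / p.τ2) * gammaSeries κ 1 (p.τ2 + p.θe * p.ψ * y)
        ∂(gammaMeasure p.k 1) = p.sumA κ - p.sumB κ - p.sumC κ := by
  have hc : 0 < p.τ2 / (p.θe * p.ψ) := by positivity
  have hae : (fun y => Real.log ((p.τ2 + p.θe * p.ψ * y) / p.τ2)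
      * gammaSeries κ 1 (p.τ2 + p.θe * p.ψ * y)) =ᵐ[gammaMeasure p.k 1] fun y =>
        ((κ - 1).factorial : ℝ) * Real.log (1 + y / (p.τ2 / (p.θe * p.ψ)))
        - ∑ a ∈ Finset.range κ, ∑ n ∈ Finset.range (a + 1), p.gammaCoeff κ a n *
          (Real.log (1 + y / (p.τ2 / (p.θe * p.ψ)))
            * (y ^ n * Real.exp (-(p.θe * p.ψ * y)))) := by
    filter_upwards [ae_nonneg_gammaMeasure p.k 1] with y hy
    exact p.log_mul_gammaSeries_one_eq hτ hw hκ hy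
  have h1 : Integrable (fun y => ((κ - 1).factorial : ℝ)
      * Real.log (1 + y / (p.τ2 / (p.θe * p.ψ)))) (gammaMeasure p.k 1) := by
    have := integrable_log_gammaMeasure hk 0 hc (s := 0) (by norm_num)
    simp only [pow_zero, zero_mul, neg_zero, Real.exp_zero, mul_one] at this
    exact this.const_mul _
  have h2 : ∀ a n, Integrable (fun y => p.gammaCoeff κ a n *
      (Real.log (1 + y / (p.τ2 / (p.θe * p.ψ))) * (y ^ n * Real.exp (-(p.θe * p.ψ * y)))))
      (gammaMeasure p.k 1) := fun a n =>
    (integrable_log_gammaMeasure hk n hc (by linarith)).const_mul _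
  have h3 : ∀ a, Integrable (fun y => ∑ n ∈ Finset.range (a + 1), p.gammaCoeff κ a n *
      (Real.log (1 + y / (p.τ2 / (p.θe * p.ψ))) * (y ^ n * Real.exp (-(p.θe * p.ψ * y)))))
      (gammaMeasure p.k 1) := fun a => integrable_finsetSum _ fun n _ => h2 a n
  have h4 : Integrable (fun y => ∑ a ∈ Finset.range κ, ∑ n ∈ Finset.range (a + 1),
      p.gammaCoeff κ a n *
      (Real.log (1 + y / (p.τ2 / (p.θe * p.ψ))) * (y ^ n * Real.exp (-(p.θe * p.ψ * y)))))
      (gammaMeasure p.k 1) := integrable_finsetSum _ fun a _ => h3 a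
  refine ⟨(h1.sub h4).congr hae.symm, ?_⟩
  rw [integral_congr_ae hae, integral_sub h1 h4, integral_const_mul,
    ← p.sumA_eq_integral hk hτ hw hκ, sub_sub, p.sumB_add_sumC hk hτ hw,
    integral_finsetSum _ fun a _ => h3 a]
  congr 1
  refine Finset.sum_congr rfl fun a _ => ?_
  rw [integral_finsetSum _ fun n _ => h2 a n]
  refine Finset.sum_congr rfl fun n _ => ?_
  rw [integral_const_mul, logMoment]

/-- The contribution of the index `κ` to the closed form, with the series summed under the
expectation. -/
theorem integrable_and_integral_inner (hk : 1 ≤ p.k) (hτ : 0 < p.τ2)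
    (hw : 0 < p.θe * p.ψ) {κ : ℕ} (hκ : 1 ≤ κ) :
    Integrable (fun y => ∫ u in p.τ2..(p.τ2 + p.θe * p.ψ * y),
        Real.log (u / p.τ2) * (u ^ (κ - 1) * Real.exp (-u))) (gammaMeasure p.k 1) ∧
      ∫ y, (∫ u in p.τ2..(p.τ2 + p.θe * p.ψ * y),
          Real.log (u / p.τ2) * (u ^ (κ - 1) * Real.exp (-u))) ∂(gammaMeasure p.k 1)
        = p.sumA κ - p.sumB κ - p.sumC κ
          - ∫ y, gammaSeries κ 2 (p.τ2 + p.θe * p.ψ * y) ∂(gammaMeasure p.k 1)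
          + hypTerm κ p.τ2 := by
  have : IsProbabilityMeasure (gammaMeasure p.k 1) :=
    isProbabilityMeasure_gammaMeasure (by exact_mod_cast hk) one_pos
  have hae : (fun y => ∫ u in p.τ2..(p.τ2 + p.θe * p.ψ * y),
      Real.log (u / p.τ2) * (u ^ (κ - 1) * Real.exp (-u))) =ᵐ[gammaMeasure p.k 1] fun y =>
        Real.log ((p.τ2 + p.θe * p.ψ * y) / p.τ2) * gammaSeries κ 1 (p.τ2 + p.θe * p.ψ * y)
          - gammaSeries κ 2 (p.τ2 + p.θe * p.ψ * y) + gammaSeries κ 2 p.τ2 := by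
    filter_upwards [ae_nonneg_gammaMeasure p.k 1] with y hy
    exact integral_log_div_mul_pow_mul_exp hκ hτ (le_add_of_nonneg_right (by positivity))
  obtain ⟨h1, h1'⟩ := p.integrable_and_integral_log_mul_gammaSeries_one hk hτ hw hκ
  have h2 := integrable_gammaSeries_affine hk hκ hτ hw 2
  have h3 : Integrable (fun y =>
      Real.log ((p.τ2 + p.θe * p.ψ * y) / p.τ2) * gammaSeries κ 1 (p.τ2 + p.θe * p.ψ * y)
        - gammaSeries κ 2 (p.τ2 + p.θe * p.ψ * y)) (gammaMeasure p.k 1) := h1.sub h2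
  refine ⟨(h3.add (integrable_const _)).congr hae.symm, ?_⟩
  rw [integral_congr_ae hae, integral_add h3 (integrable_const _), integral_sub h1 h2, h1',
    hypTerm_eq_gammaSeries hκ]
  simp

end Params

/-! ### Normalised gains and Fubini's theorem. -/

namespace Params

variable (p : Params)

/-- The Case II event in terms of the normalised gains `x = gp / θe`, `y = gs / θe`. -/
def caseSet : Set (ℝ × ℝ) := {q | p.τ1 ≤ q.1 ∧ q.1 ≤ p.τ1 + p.θe * p.ψ * q.2}

/-- The rate in terms of the normalised gain `x = gp / θe`. -/
def normRate (x : ℝ) : ℝ := Real.logb 2 (x / p.τ2 - p.ζ2)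

theorem measurableSet_caseSet : MeasurableSet p.caseSet :=
  (measurableSet_le measurable_const measurable_fst).inter
    (measurableSet_le measurable_fst (by fun_prop))

theorem measurable_normRate : Measurable p.normRate :=
  (Real.measurable_log.comp (by fun_prop : Measurable fun x => x / p.τ2 - p.ζ2)).div_const _

theorem inCaseII_iff (hLp : 0 < p.Lp) (hθ : 0 < p.θe) (x y : ℝ) :
    p.InCaseII x y ↔ (p.θe⁻¹ * x, p.θe⁻¹ * y) ∈ p.caseSet := by
  have h1 : p.τ1 ≤ p.θe⁻¹ * x ↔ p.γp ≤ p.Lp * x := by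
    rw [τ1, div_le_iff₀ (by positivity), show p.θe⁻¹ * x * (p.Lp * p.θe) = p.Lp * x by field_simp]
  have h2 : p.θe⁻¹ * x ≤ p.τ1 + p.θe * p.ψ * (p.θe⁻¹ * y) ↔
      p.Lp * x ≤ p.γp * (1 + (1 - p.α) * p.Ls * y) := by
    rw [show p.τ1 + p.θe * p.ψ * (p.θe⁻¹ * y)
      = p.γp * (1 + (1 - p.α) * p.Ls * y) / (p.Lp * p.θe) by rw [τ1, ψ]; field_simp,
      le_div_iff₀ (by positivity), show p.θe⁻¹ * x * (p.Lp * p.θe) = p.Lp * x by field_simp]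
  exact and_congr h1.symm h2.symm

theorem rateII_eq_normRate (hγ : 0 < p.γp) (hLp : 0 < p.Lp) (hθ : 0 < p.θe) (_ : 0 ≤ p.ζ2)
    (x : ℝ) : p.rateII x = p.normRate (p.θe⁻¹ * x) := by
  rw [rateII, normRate, τ2, τ1]
  congr 2
  field_simp
  ring

theorem τ2_add (hζ : 0 ≤ p.ζ2) : p.τ2 + p.ζ2 * p.τ2 = p.τ1 := by
  rw [τ2]
  field_simp
  ring

theorem integrableOn_normRate (hk : 1 ≤ p.k) (hζ : 0 ≤ p.ζ2) (hτ : 0 < p.τ2) :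
    IntegrableOn (fun q : ℝ × ℝ => p.normRate q.1) p.caseSet
      ((gammaMeasure p.k 1).prod (gammaMeasure p.k 1)) := by
  have : IsProbabilityMeasure (gammaMeasure p.k 1) :=
    isProbabilityMeasure_gammaMeasure (by exact_mod_cast hk) one_pos
  have hX : Integrable (fun x : ℝ => x) (gammaMeasure p.k 1) := by
    simpa using integrable_pow_gammaMeasure hk 1
  have hb : Integrable (fun q : ℝ × ℝ => q.1 / p.τ2 / Real.log 2)
      ((gammaMeasure p.k 1).prod (gammaMeasure p.k 1)) :=
    ((hX.div_const p.τ2).div_const (Real.log 2)).comp_fst _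
  refine hb.integrableOn.mono' (p.measurable_normRate.comp measurable_fst).aestronglyMeasurable
    (ae_restrict_of_forall_mem p.measurableSet_caseSet fun q hq => ?_)
  -- On the event x ≥ τ1 = τ2 (1 + ζ2), so the rate is nonnegative and log t ≤ t - 1 gives a linear
  -- majorant.
  have h1 : 1 ≤ q.1 / p.τ2 - p.ζ2 := by
    rw [le_sub_iff_add_le, le_div_iff₀ hτ, add_mul, one_mul, p.τ2_add hζ]
    exact hq.1
  have h2 : 0 < Real.log 2 := Real.log_pos one_lt_two
  rw [normRate, Real.logb, Real.norm_of_nonneg (div_nonneg (Real.log_nonneg h1) h2.le)]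
  gcongr
  have := Real.log_le_sub_one_of_pos (one_pos.trans_le h1)
  linarith

theorem integral_normRate_Icc (hζ : 0 ≤ p.ζ2) (hτ : 0 < p.τ2) {z : ℝ} (hz : 0 ≤ z) :
    ∫ x in (p.τ1)..(p.τ1 + z), p.normRate x * (x ^ (p.k - 1) * Real.exp (-x))
      = Real.exp (-(p.ζ2 * p.τ2)) / Real.log 2 * ∑ i ∈ Finset.range (p.k - 1 + 1),
        ((p.k - 1).choose i : ℝ) * (p.ζ2 * p.τ2) ^ i
          * ∫ u in (p.τ2)..(p.τ2 + z),
            Real.log (u / p.τ2) * (u ^ (p.k - 1 - i) * Real.exp (-u)) := by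
  rw [← p.τ2_add hζ, add_right_comm, ← intervalIntegral.integral_comp_add_right]
  have hcont : ∀ i, IntervalIntegrable
      (fun u => ((p.k - 1).choose i : ℝ) * (p.ζ2 * p.τ2) ^ i
        * (Real.log (u / p.τ2) * (u ^ (p.k - 1 - i) * Real.exp (-u)))) volume p.τ2 (p.τ2 + z) := by
    intro i
    refine ContinuousOn.intervalIntegrable fun u hu => ContinuousAt.continuousWithinAt ?_
    rw [Set.uIcc_of_le (by linarith)] at hu
    have h0 : 0 < u := hτ.trans_le hu.1
    have : u / p.τ2 ≠ 0 := by positivity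
    fun_prop (disch := assumption)
  simp_rw [← intervalIntegral.integral_const_mul (_ * _)]
  rw [← intervalIntegral.integral_finsetSum fun i _ => hcont i,
    ← intervalIntegral.integral_const_mul]
  refine intervalIntegral.integral_congr fun u _ => ?_
  rw [normRate, Real.logb, show (u + p.ζ2 * p.τ2) / p.τ2 - p.ζ2 = u / p.τ2 by field_simp; ring,
    add_comm u, add_pow, neg_add, Real.exp_add, Finset.sum_mul, Finset.mul_sum, Finset.mul_sum]
  refine Finset.sum_congr rfl fun i _ => ?_
  ring

theorem setIntegral_normRate (hk : 1 ≤ p.k) (hζ : 0 ≤ p.ζ2) (hτ : 0 < p.τ2)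
    (hw : 0 < p.θe * p.ψ) :
    ∫ q in p.caseSet, p.normRate q.1 ∂((gammaMeasure p.k 1).prod (gammaMeasure p.k 1))
      = p.closedForm fun κ =>
        ∫ y, gammaSeries κ 2 (p.τ2 + p.θe * p.ψ * y) ∂(gammaMeasure p.k 1) := by
  have : IsProbabilityMeasure (gammaMeasure p.k 1) :=
    isProbabilityMeasure_gammaMeasure (by exact_mod_cast hk) one_pos
  have hτ1 : 0 < p.τ1 := by
    rw [← p.τ2_add hζ]
    positivity
  have hint := p.integrableOn_normRate hk hζ hτ
  rw [← integrable_indicator_iff p.measurableSet_caseSet] at hint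
  -- The primary gain is integrated first, for a fixed secondary gain y.
  rw [← integral_indicator p.measurableSet_caseSet, integral_prod_symm _ hint]
  have hinner : ∀ᵐ y ∂(gammaMeasure p.k 1),
      ∫ x, p.caseSet.indicator (fun q : ℝ × ℝ => p.normRate q.1) (x, y) ∂(gammaMeasure p.k 1)
        = ((p.k - 1).factorial : ℝ)⁻¹ * (Real.exp (-(p.ζ2 * p.τ2)) / Real.log 2)
          * ∑ i ∈ Finset.range (p.k - 1 + 1), ((p.k - 1).choose i : ℝ) * (p.ζ2 * p.τ2) ^ i
            * ∫ u in (p.τ2)..(p.τ2 + p.θe * p.ψ * y),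
              Real.log (u / p.τ2) * (u ^ (p.k - 1 - i) * Real.exp (-u)) := by
    filter_upwards [ae_nonneg_gammaMeasure p.k 1] with y hy
    have hz : 0 ≤ p.θe * p.ψ * y := by positivity
    rw [integral_gammaMeasure hk, mul_assoc _ _ (Finset.sum _ _),
      ← p.integral_normRate_Icc hζ hτ hz, intervalIntegral.integral_of_le (by linarith),
      ← integral_Icc_eq_integral_Ioc, ← integral_indicator measurableSet_Ioi,
      ← integral_indicator measurableSet_Icc]
    congr 1
    refine integral_congr_ae (.of_forall fun x => ?_)
    by_cases hx : x ∈ Set.Icc p.τ1 (p.τ1 + p.θe * p.ψ * y)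
    · have hx' : (x, y) ∈ p.caseSet := hx
      have hx0 : x ∈ Set.Ioi 0 := hτ1.trans_le hx.1
      rw [Set.indicator_of_mem hx0, Set.indicator_of_mem hx, Set.indicator_of_mem hx']
    · have hx' : (x, y) ∉ p.caseSet := hx
      simp [Set.indicator_of_notMem hx, Set.indicator_of_notMem hx']
  have hinn := fun i => p.integrable_and_integral_inner hk hτ hw (κ := p.k - i)
  rw [integral_congr_ae hinner, integral_const_mul, Nat.sub_add_cancel hk, integral_finsetSum]
  · rw [closedForm]
    congr 1
    · rw [show p.ζ2 * p.τ1 / (p.ζ2 + 1) = p.ζ2 * p.τ2 by rw [τ2]; ring,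
        ← Real.Gamma_nat_eq_factorial, show ((p.k - 1 : ℕ) : ℝ) + 1 = p.k by
          rw [Nat.cast_sub hk]; simp]
      ring
    · refine Finset.sum_congr rfl fun i hi => ?_
      rw [integral_const_mul, Nat.sub_right_comm,
        (hinn i (by have := Finset.mem_range.1 hi; omega)).2]
  · intro i hi
    rw [Nat.sub_right_comm]
    exact (hinn i (by have := Finset.mem_range.1 hi; omega)).1.const_mul _

theorem closedForm_congr {S S' : ℕ → ℝ} (h : ∀ κ ∈ Finset.Icc 1 p.k, S κ = S' κ) :
    p.closedForm S = p.closedForm S' := by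
  unfold closedForm
  congr 1
  refine Finset.sum_congr rfl fun i hi => ?_
  rw [h (p.k - i) (Finset.mem_Icc.2 (by have := Finset.mem_range.1 hi; omega))]

end Params

/-! ### Transfer to the probability space. -/

theorem HasLaw.inv_mul_gammaMeasure {Ω : Type*} [MeasurableSpace Ω] {P : Measure Ω} {a θ : ℝ}
    (hθ : 0 < θ) {g : Ω → ℝ} (hg : HasLaw g (gammaMeasure a (1 / θ)) P) :
    HasLaw (fun ω => θ⁻¹ * g ω) (gammaMeasure a 1) P :=
  HasLaw.fun_comp (Y := fun x => θ⁻¹ * x) ⟨by fun_prop, map_gammaMeasure hθ⟩ hg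

theorem proposition3 {Ω : Type*} [MeasurableSpace Ω] (P : Measure Ω) [IsProbabilityMeasure P]
    (p : Params) (hk : 1 ≤ p.k) (hα0 : 0 ≤ p.α) (hα1 : p.α < 1) (hγ : 0 < p.γp)
    (hLp : 0 < p.Lp) (hLs : 0 < p.Ls) (hθ : 0 < p.θe)
    (gp gs : Ω → ℝ)
    (hgp : HasLaw gp (gammaMeasure p.k (1 / p.θe)) P)
    (hgs : HasLaw gs (gammaMeasure p.k (1 / p.θe)) P)
    (hind : IndepFun gp gs P) :
    -- the rate has a finite expectation over the Case II event
    IntegrableOn (fun ω => p.rateII (gp ω)) {ω | p.InCaseII (gp ω) (gs ω)} P ∧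
    -- the closed form holds whenever its infinite series converge
    (∀ S : ℕ → ℝ,
      (∀ κ ∈ Finset.Icc 1 p.k,
        Tendsto (fun J : ℕ => ∑ j ∈ Finset.range J, p.seriesTerm κ j) atTop (𝓝 (S κ))) →
      p.ER2 P gp gs = p.closedForm S) ∧
    -- the infinite series converge absolutely exactly when `θe * ψ < 1`
    (∀ κ ∈ Finset.Icc 1 p.k, (Summable (p.seriesTerm κ) ↔ p.θe * p.ψ < 1)) ∧
    -- for all parameters, the closed form holds with the summation of the series under the
    -- expectation over `gs`
    (∀ κ ∈ Finset.Icc 1 p.k, Integrable (fun ω => Params.hypTerm κ (p.τ2 + p.ψ * gs ω)) P) ∧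
    p.ER2 P gp gs
      = p.closedForm (fun κ => ∫ ω, Params.hypTerm κ (p.τ2 + p.ψ * gs ω) ∂P) := by
  have hα : 0 < 1 - p.α := by linarith
  have hζ : 0 ≤ p.ζ2 := by unfold Params.ζ2; positivity
  have hτ : 0 < p.τ2 := by unfold Params.τ2 Params.τ1; positivity
  have hw : 0 < p.θe * p.ψ := by unfold Params.ψ; positivity
  have hX := HasLaw.inv_mul_gammaMeasure hθ hgp
  have hY := HasLaw.inv_mul_gammaMeasure hθ hgs
  have hXY : IndepFun (fun ω => p.θe⁻¹ * gp ω) (fun ω => p.θe⁻¹ * gs ω) P :=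
    hind.comp (φ := fun x => p.θe⁻¹ * x) (ψ := fun x => p.θe⁻¹ * x) (by fun_prop) (by fun_prop)
  have hpair : P.map (fun ω => (p.θe⁻¹ * gp ω, p.θe⁻¹ * gs ω))
      = (gammaMeasure p.k 1).prod (gammaMeasure p.k 1) := by
    rw [(indepFun_iff_map_prod_eq_prod_map_map hX.aemeasurable hY.aemeasurable).1 hXY, hX.map_eq,
      hY.map_eq]
  have hpm : AEMeasurable (fun ω => (p.θe⁻¹ * gp ω, p.θe⁻¹ * gs ω)) P :=
    hX.aemeasurable.prodMk hY.aemeasurable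
  have hset : {ω | p.InCaseII (gp ω) (gs ω)}
      = (fun ω => (p.θe⁻¹ * gp ω, p.θe⁻¹ * gs ω)) ⁻¹' p.caseSet :=
    Set.ext fun ω => p.inCaseII_iff hLp hθ _ _
  have hrate : (fun ω => p.rateII (gp ω)) = fun ω => p.normRate (p.θe⁻¹ * gp ω) :=
    funext fun ω => p.rateII_eq_normRate hγ hLp hθ hζ _
  have hmeas : Measurable fun q : ℝ × ℝ => p.normRate q.1 :=
    p.measurable_normRate.comp measurable_fst
  have hER : p.ER2 P gp gs = p.closedForm fun κ =>
      ∫ y, gammaSeries κ 2 (p.τ2 + p.θe * p.ψ * y) ∂(gammaMeasure p.k 1) := by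
    rw [← p.setIntegral_normRate hk hζ hτ hw, ← hpair,
      setIntegral_map p.measurableSet_caseSet hmeas.aestronglyMeasurable hpm, Params.ER2, hset,
      hrate]
  have hhyp : ∀ κ, 1 ≤ κ → ∀ ω, Params.hypTerm κ (p.τ2 + p.ψ * gs ω)
      = gammaSeries κ 2 (p.τ2 + p.θe * p.ψ * (p.θe⁻¹ * gs ω)) := fun κ hκ ω => by
    rw [hypTerm_eq_gammaSeries hκ,
      show p.θe * p.ψ * (p.θe⁻¹ * gs ω) = p.ψ * gs ω by field_simp]
  refine ⟨?_, fun S hS => ?_, fun κ hκ => ?_, fun κ hκ => ?_, ?_⟩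
  · have h := p.integrableOn_normRate hk hζ hτ
    rw [← hpair, IntegrableOn,
      Measure.restrict_map_of_aemeasurable hpm p.measurableSet_caseSet] at h
    rw [hset, hrate]
    exact h.comp_aemeasurable hpm.restrict
  · rw [hER]
    exact p.closedForm_congr fun κ hκ =>
      (p.eq_integral_of_tendsto_seriesTerm hk (Finset.mem_Icc.1 hκ).1 hτ hw (hS κ hκ)).symm
  · exact p.summable_seriesTerm_iff hk (Finset.mem_Icc.1 hκ).1 hτ hw
  · have h1 := (Finset.mem_Icc.1 hκ).1
    simp_rw [hhyp κ h1]
    have h := integrable_gammaSeries_affine hk h1 hτ hw 2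
    rw [← hY.map_eq] at h
    exact h.comp_aemeasurable hY.aemeasurable
  · rw [hER]
    refine p.closedForm_congr fun κ hκ => ?_
    have h1 := (Finset.mem_Icc.1 hκ).1
    simp_rw [hhyp κ h1]
    exact (hY.integral_comp (f := fun y => gammaSeries κ 2 (p.τ2 + p.θe * p.ψ * y))
      (integrable_gammaSeries_affine hk h1 hτ hw 2).aestronglyMeasurable).symm

end
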